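/- Let $\Omega$ be a Euclidean space (a finite-dimensional real inner product space), let $N\ge 1$, let $f_1,\dots,f_N:\Omega\to\mathbb R$ be continuous and convex, suppose that $E=\frac1N\sum_{j=1}^N f_j$ is coercive, i.e. $E(\theta)\to\infty$ as $\|\theta\|\to\infty$, and let $\theta^*$ be a minimizer of $E$. For $\alpha>0$ put $f_j^\alpha=f_j+\frac\alpha2\|\cdot\|^2$ and $E^\alpha=\frac1N\sum_{j=1}^N f_j^\alpha = E+\frac\alpha2\|\cdot\|^2$. The algorithm DualFL applied to the minimization of $E^\alpha$ with hyperparameters $\rho=0$ and $\nu=\alpha$ generates sequences as follows. Start from $\theta^{(0)}=\theta_j^{(0)}=\zeta_j^{(0)}=\zeta_j^{(-1)}=0$ ($1\le j\le N$) and $t_0=1$. For $n=0,1,2,\dots$, each client $j$ computes, by any local solver, an approximate minimizer $\theta_j^{(n+1)}$ of $$E^{n,j}(\vartheta)=f_j^\alpha(\vartheta)-\nu\langle\zeta_j^{(n)},\vartheta\rangle ,\qquad \vartheta\in\Omega,$$ and then $$\theta^{(n+1)}=\frac1N\sum_{j=1}^N\theta_j^{(n+1)},\qquad \zeta_j^{(n+1)}=(1+\beta_n)\bigl(\zeta_j^{(n)}+\theta^{(n+1)}-\theta_j^{(n+1)}\bigr)-\beta_n\bigl(\zeta_j^{(n-1)}+\theta^{(n)}-\theta_j^{(n)}\bigr),$$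 where $$t_{n+1}=\frac{1-\rho t_n^2+\sqrt{(1-\rho t_n^2)^2+4t_n^2}}2,\qquad \beta_n=\frac{t_n-1}{t_{n+1}}\cdot\frac{1-t_{n+1}\rho}{1-\rho}.$$ Suppose that the local problems are solved so accurately that, for some $\gamma>0$ (which may depend on $\alpha$), for all $n\ge0$ and $1\le j\le N$, $$\Gamma^{n,j}(\theta_j^{(n+1)})\le\frac1{N\nu(n+1)^{4+\gamma}},$$ where the primal-dual gap is $$\Gamma^{n,j}(\vartheta)=E^{n,j}(\vartheta)+E_{\mathrm d}^{n,j}\bigl(\nu(\zeta_j^{(n)}-\vartheta)\bigr),\qquad E_{\mathrm d}^{n,j}(\xi)=g_j^*(\xi)+\frac1{2\nu}\bigl\|\xi-\nu\zeta_j^{(n)}\bigr\|^2,$$ with $g_j=f_j^\alpha-\frac\nu2\|\cdot\|^2$ and $g_j^*(p)=\sup_{x\in\Omega}\{\langle p,x\rangle-g_j(x)\}\in(-\infty,+\infty]$. Then $E(\theta^{(n)})-E(\theta^*)\to0$ as $n\to\infty$ and $\alpha\to0^+$, in the following sense: for every $\alpha>0$ the limit $$\ell(\alpha)=\lim_{n\to\infty}\bigl(E(\theta^{(n)})-E(\theta^*)\bigr)$$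 exists and depends neither on the choice of the local solutions $\theta_j^{(n+1)}$ nor on $\gamma$, as long as the accuracy condition holds, and $\ell(\alpha)\to0$ as $\alpha\to0^+$. -/

import Mathlib

open Filter Topology

noncomputable section

namespace DualFL

variable {Ω : Type*} [NormedAddCommGroup Ω] [InnerProductSpace ℝ Ω] {N : ℕ}

/-- The global cost `E(θ) = (1/N) ∑ⱼ fⱼ(θ)`. -/
def cost (f : Fin N → Ω → ℝ) (θ : Ω) : ℝ :=
  (1 / (N : ℝ)) * ∑ j, f j θ

/-- The `ℓ²`-regularized local costs `fⱼ(θ) + (α/2)‖θ‖²`. -/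
def regularize (f : Fin N → Ω → ℝ) (α : ℝ) : Fin N → Ω → ℝ :=
  fun j θ => f j θ + α / 2 * ‖θ‖ ^ 2

/-- The Legendre--Fenchel conjugate `h*(p) = sup_x (⟨p, x⟩ - h(x))`, with values in the
extended reals. -/
def conjugate (h : Ω → ℝ) (p : Ω) : EReal :=
  ⨆ x : Ω, ((inner ℝ p x - h x : ℝ) : EReal)

/-- The local objective `θ ↦ h(θ) - ν⟨ζ, θ⟩` of a client with cost `h` and control variate `ζ`. -/
def localPrimal (h : Ω → ℝ) (ν : ℝ) (ζ θ : Ω) : ℝ :=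
  h θ - ν * inner ℝ ζ θ

/-- The local dual objective `ξ ↦ g*(ξ) + (1/(2ν))‖ξ - νζ‖²`, where `g = h - (ν/2)‖·‖²`. -/
def localDual (h : Ω → ℝ) (ν : ℝ) (ζ ξ : Ω) : EReal :=
  conjugate (fun θ => h θ - ν / 2 * ‖θ‖ ^ 2) ξ
    + ((1 / (2 * ν) * ‖ξ - ν • ζ‖ ^ 2 : ℝ) : EReal)

/-- The local primal-dual gap: the primal objective at `θ` plus the dual objective
at `ν(ζ - θ)`. Neither summand is `-∞`. -/
def gap (h : Ω → ℝ) (ν : ℝ) (ζ θ : Ω) : EReal :=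
  (localPrimal h ν ζ θ : EReal) + localDual h ν ζ (ν • (ζ - θ))

/-- The scalars `t₀ = 1`, `tₙ₊₁ = (1 - ρtₙ² + √((1 - ρtₙ²)² + 4tₙ²)) / 2`. -/
def tSeq (ρ : ℝ) : ℕ → ℝ
  | 0 => 1
  | n + 1 =>
      (1 - ρ * tSeq ρ n ^ 2 + √((1 - ρ * tSeq ρ n ^ 2) ^ 2 + 4 * tSeq ρ n ^ 2)) / 2

/-- The overrelaxation parameters `βₙ = ((tₙ - 1)/tₙ₊₁) · ((1 - tₙ₊₁ρ)/(1 - ρ))`. -/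
def betaSeq (ρ : ℝ) (n : ℕ) : ℝ :=
  (tSeq ρ n - 1) / tSeq ρ (n + 1) * ((1 - tSeq ρ (n + 1) * ρ) / (1 - ρ))

/-- The control variates of the previous epoch, `ζ⁽ⁿ⁻¹⁾`, with the convention `ζ⁽⁻¹⁾ = 0`. -/
def previous (ζ : ℕ → Fin N → Ω) : ℕ → Fin N → Ω
  | 0 => 0
  | n + 1 => ζ n

/-- `θ` (server parameters), `φ` (local solutions, `φ n j = θⱼ⁽ⁿ⁾`) and `ζ` (control variates)
are generated by DualFL with hyperparameter `ρ`. The local solutions `φ (n + 1) j` come from an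
arbitrary local solver; how well they solve the local problems is expressed by `IsAccurate`. -/
structure IsRun (ρ : ℝ) (θ : ℕ → Ω) (φ ζ : ℕ → Fin N → Ω) : Prop where
  server_zero : θ 0 = 0
  local_zero : φ 0 = 0
  control_zero : ζ 0 = 0
  server_succ : ∀ n, θ (n + 1) = (1 / (N : ℝ)) • ∑ j, φ (n + 1) j
  control_succ : ∀ n j, ζ (n + 1) j =
    (1 + betaSeq ρ n) • (ζ n j + θ (n + 1) - φ (n + 1) j)
      - betaSeq ρ n • (previous ζ n j + θ n - φ n j)

/-- Each local problem is solved so accurately that the primal-dual gap of the new local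
solution is at most `1 / (N ν (n + 1)^(4 + γ))`. -/
def IsAccurate (f : Fin N → Ω → ℝ) (ν γ : ℝ) (φ ζ : ℕ → Fin N → Ω) : Prop :=
  ∀ (n : ℕ) (j : Fin N), gap (f j) ν (ζ n j) (φ (n + 1) j) ≤
    ((1 / ((N : ℝ) * ν * ((n : ℝ) + 1) ^ (4 + γ)) : ℝ) : EReal)

end DualFL

end

namespace DualFL

/-! For `ν = α` the function `g_j` is `f_j` itself, and DualFL is inexact FISTA with step `1/α` for
the dual problem of minimizing `∑ f_j*(α u_j) + (α/(2N))‖∑ u_j‖²` over `Ω^N`. Its iterates are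
`u_j⁽ⁿ⁾ = ζ_j⁽ⁿ⁻¹⁾ - θ_j⁽ⁿ⁾`, whose sum is `-N θ⁽ⁿ⁾`. The local errors stay summable after weighting
by `tₙ²`, so the dual gap is `O(1/n²)` (`dual_step_le`, `accelerated_energy_le`).

The dual gap dominates `(αN/2)‖θ⁽ⁿ⁾ - y‖²`, where `y` minimizes `E^α` (`dual_gap_ge`); the dual
optimum this needs comes from subgradients of the `f_j` at `y` with sum `-Nα y`
(`exists_subgradients_of_sum`). Hence `θ⁽ⁿ⁾ → y` and `ℓ(α) = E(y) - E(θ*)`, which lies between `0`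
and `(α/2)‖θ*‖²`. -/

/-! ### Convex analysis: subgradients and the primal-dual gap. -/

/-- If a continuous affine minorant of `x ↦ ∑ⱼ fⱼ(x)` is exact at `x₀`, its slope splits into
subgradients of the `fⱼ` at `x₀`. -/
theorem exists_subgradients_of_sum {Ω : Type*} [NormedAddCommGroup Ω] [InnerProductSpace ℝ Ω]
    [FiniteDimensional ℝ Ω] {N : ℕ} (f : Fin N → Ω → ℝ)
    (hcont : ∀ j, Continuous (f j)) (hconv : ∀ j, ConvexOn ℝ Set.univ (f j)) (x₀ v : Ω)
    (h : ∀ x, ∑ j, f j x₀ + inner ℝ v (x - x₀) ≤ ∑ j, f j x) :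
    ∃ p : Fin N → Ω, ∑ j, p j = v ∧ ∀ j x, f j x₀ + inner ℝ (p j) (x - x₀) ≤ f j x := by
  classical
  -- Hahn-Banach separates the strict epigraph of the decoupled sum `∑ f_j(x_j)` from the graph of
  -- the affine minorant over the diagonal.
  let s : Set ((Fin N → Ω) × ℝ) := {z | ∑ j, f j (z.1 j) < z.2}
  let t : Set ((Fin N → Ω) × ℝ) :=
    Set.range fun x : Ω => ((fun _ => x), ∑ j, f j x₀ + inner ℝ v (x - x₀))
  have hs : Convex ℝ s := by
    intro z hz z' hz' a b ha hb hab
    simp only [s, Set.mem_ofPred_eq] at hz hz' ⊢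
    have h1 : ∑ j, f j ((a • z + b • z').1 j) ≤ a * ∑ j, f j (z.1 j) + b * ∑ j, f j (z'.1 j) := by
      rw [Finset.mul_sum, Finset.mul_sum, ← Finset.sum_add_distrib]
      refine Finset.sum_le_sum fun j _ => ?_
      simpa using (hconv j).2 (Set.mem_univ (z.1 j)) (Set.mem_univ (z'.1 j)) ha hb hab
    refine h1.trans_lt ?_
    have h2 : (a • z + b • z').2 = a * z.2 + b * z'.2 := by simp
    rw [h2]
    rcases ha.eq_or_lt with rfl | ha'
    · have : b = 1 := by linarith
      subst this; linarith
    · nlinarith [mul_lt_mul_of_pos_left hz ha', mul_le_mul_of_nonneg_left hz'.le hb]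
  have hso : IsOpen s := by
    refine isOpen_lt ?_ continuous_snd
    refine continuous_finsetSum _ fun j _ => (hcont j).comp ?_
    exact (continuous_apply j).comp continuous_fst
  have ht : Convex ℝ t := by
    rintro _ ⟨x, rfl⟩ _ ⟨y, rfl⟩ a b ha hb hab
    refine ⟨a • x + b • y, ?_⟩
    refine Prod.ext (by ext j; simp) ?_
    simp only [Prod.snd_add, Prod.smul_snd, smul_eq_mul, inner_sub_right, inner_add_right,
      inner_smul_right]
    linear_combination (-(∑ j, f j x₀) + inner ℝ v x₀) * hab
  have hd : Disjoint s t := by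
    rw [Set.disjoint_left]
    rintro z hz ⟨x, rfl⟩
    exact absurd (h x) (not_le.2 hz)
  obtain ⟨F, u, hFs, hFt⟩ := geometric_hahn_banach_open hs hso ht hd
  let c : ℝ := F (0, 1)
  let L : Fin N → Ω →L[ℝ] ℝ := fun j =>
    F.comp ((ContinuousLinearMap.inl ℝ (Fin N → Ω) ℝ).comp
      (ContinuousLinearMap.single ℝ (fun _ : Fin N => Ω) j))
  have hF : ∀ (x : Fin N → Ω) (r : ℝ), F (x, r) = ∑ j, L j (x j) + c * r := by
    intro x r
    have h1 : (x, r) = ∑ j, ((Pi.single j (x j) : Fin N → Ω), (0 : ℝ)) + r • ((0 : Fin N → Ω), (1 : ℝ)) := by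
      refine Prod.ext ?_ ?_
      · simp [Prod.fst_sum, Finset.univ_sum_single]
      · simp [Prod.snd_sum]
    rw [h1, map_add, map_sum, map_smul, smul_eq_mul, mul_comm]
    rfl
  have key : ∀ (x : Fin N → Ω) (r : ℝ) (y : Ω), ∑ j, f j (x j) < r →
      ∑ j, L j (x j) + c * r < ∑ j, L j y + c * (∑ j, f j x₀ + inner ℝ v (y - x₀)) := by
    intro x r y hr
    rw [← hF, ← hF (fun _ => y)]
    exact (hFs _ hr).trans_le (hFt _ ⟨y, rfl⟩)
  have hc : c < 0 := by
    have := key (fun _ => x₀) (∑ j, f j x₀ + 1) x₀ (by linarith)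
    simp only [sub_self, inner_zero_right] at this
    linarith
  have key2 : ∀ (x : Fin N → Ω) (y : Ω), ∑ j, L j (x j) + c * ∑ j, f j (x j) ≤
      ∑ j, L j y + c * (∑ j, f j x₀ + inner ℝ v (y - x₀)) := by
    intro x y
    have h1 : Tendsto (fun r => ∑ j, L j (x j) + c * r) (𝓝[>] (∑ j, f j (x j)))
        (𝓝 (∑ j, L j (x j) + c * ∑ j, f j (x j))) :=
      ((by fun_prop : Continuous fun r => ∑ j, L j (x j) + c * r).tendsto _).mono_left
        nhdsWithin_le_nhds
    refine le_of_tendsto h1 ?_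
    filter_upwards [self_mem_nhdsWithin] with r hr
    exact (key x r y hr).le
  have hv : ∀ y, ∑ j, L j y = -c * inner ℝ v y := by
    have h1 : ∀ y, 0 ≤ ∑ j, L j y + c * inner ℝ v y := by
      intro y
      have := key2 (fun _ => x₀) (x₀ + y)
      simp only [map_add, Finset.sum_add_distrib, add_sub_cancel_left] at this
      linarith
    intro y
    have h2 := h1 y
    have h3 := h1 (-y)
    simp only [map_neg, Finset.sum_neg_distrib, inner_neg_right] at h3
    linarith
  let q : Fin N → Ω := fun j => (InnerProductSpace.toDual ℝ Ω).symm (L j)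
  have hq : ∀ j x, inner ℝ (q j) x = L j x := fun j x => by simp [q]
  refine ⟨fun j => (-c)⁻¹ • q j, ?_, ?_⟩
  · refine ext_inner_right ℝ fun y => ?_
    rw [← Finset.smul_sum, real_inner_smul_left, sum_inner]
    simp only [hq, hv]
    rw [inv_mul_cancel_left₀ (neg_ne_zero.2 hc.ne)]
  · intro j x
    -- Moving only coordinate `j` away from `x₀` isolates `f_j`.
    have h1 := key2 (Function.update (fun _ => x₀) j x) x₀
    have e1 : ∀ G : Fin N → Ω → ℝ, ∑ i, G i (Function.update (fun _ => x₀) j x i) =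
        ∑ i, G i x₀ + (G j x - G j x₀) := by
      intro G
      rw [← sub_eq_iff_eq_add', ← Finset.sum_sub_distrib, Finset.sum_eq_single j]
      · simp
      · intro i _ hi; simp [hi]
      · simp
    rw [e1 fun i => ⇑(L i), e1 f] at h1
    simp only [sub_self, inner_zero_right] at h1
    rw [real_inner_smul_left, hq, map_sub]
    have h2 : L j x - L j x₀ ≤ (-c) * (f j x - f j x₀) := by linarith
    have h3 := (inv_mul_le_iff₀ (neg_pos.2 hc)).2 h2
    linarith

/-- First-order optimality for a convex function plus a quadratic. -/
theorem subgradient_of_isMin_add_sq {Ω : Type*} [NormedAddCommGroup Ω] [InnerProductSpace ℝ Ω]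
    {F : Ω → ℝ} (hF : ConvexOn ℝ Set.univ F) {κ : ℝ} {x₀ : Ω}
    (hmin : ∀ x, F x₀ + κ / 2 * ‖x₀‖ ^ 2 ≤ F x + κ / 2 * ‖x‖ ^ 2) (x : Ω) :
    F x₀ + inner ℝ (-κ • x₀) (x - x₀) ≤ F x := by
  have h1 : ∀ s ∈ Set.Ioc (0 : ℝ) 1,
      0 ≤ F x - F x₀ + κ * inner ℝ x₀ (x - x₀) + s * (κ / 2 * ‖x - x₀‖ ^ 2) := by
    rintro s ⟨hs0, hs1⟩
    have h2 := hmin (x₀ + s • (x - x₀))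
    have h3 := hF.2 (Set.mem_univ x₀) (Set.mem_univ x) (sub_nonneg.2 hs1) hs0.le
      (sub_add_cancel 1 s)
    have h4 : (1 - s) • x₀ + s • x = x₀ + s • (x - x₀) := by module
    rw [h4, smul_eq_mul, smul_eq_mul] at h3
    rw [norm_add_sq_real, norm_smul, mul_pow, Real.norm_eq_abs, sq_abs, inner_smul_right] at h2
    have h5 : 0 ≤ s * (F x - F x₀ + κ * inner ℝ x₀ (x - x₀) + s * (κ / 2 * ‖x - x₀‖ ^ 2)) := by
      linarith
    exact nonneg_of_mul_nonneg_right h5 hs0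
  have h2 : Tendsto (fun s : ℝ => F x - F x₀ + κ * inner ℝ x₀ (x - x₀) +
      s * (κ / 2 * ‖x - x₀‖ ^ 2)) (𝓝[>] 0)
      (𝓝 (F x - F x₀ + κ * inner ℝ x₀ (x - x₀) + 0 * (κ / 2 * ‖x - x₀‖ ^ 2))) :=
    ((by fun_prop : Continuous fun s : ℝ => F x - F x₀ + κ * inner ℝ x₀ (x - x₀) +
      s * (κ / 2 * ‖x - x₀‖ ^ 2)).tendsto 0).mono_left nhdsWithin_le_nhds
  have h3 := ge_of_tendsto h2 (by
    filter_upwards [Ioc_mem_nhdsGT zero_lt_one] with s hs using h1 s hs)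
  rw [real_inner_smul_left]
  linarith

/-- A small primal-dual gap makes `ν(ζ - θ)` an approximate subgradient of
`h - (ν/2)‖·‖²` at `θ`. -/
theorem approx_subgradient_of_gap_le {Ω : Type*} [NormedAddCommGroup Ω] [InnerProductSpace ℝ Ω]
    {h : Ω → ℝ} {ν ε : ℝ} (hν : ν ≠ 0) {ζ θ : Ω} (hgap : gap h ν ζ θ ≤ (ε : EReal)) (x : Ω) :
    inner ℝ (ν • (ζ - θ)) x - (h x - ν / 2 * ‖x‖ ^ 2) ≤
      inner ℝ (ν • (ζ - θ)) θ - (h θ - ν / 2 * ‖θ‖ ^ 2) + ε := by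
  have h1 : ((inner ℝ (ν • (ζ - θ)) x - (h x - ν / 2 * ‖x‖ ^ 2) : ℝ) : EReal) ≤
      conjugate (fun θ => h θ - ν / 2 * ‖θ‖ ^ 2) (ν • (ζ - θ)) :=
    le_iSup (fun x : Ω => ((inner ℝ (ν • (ζ - θ)) x - (h x - ν / 2 * ‖x‖ ^ 2) : ℝ) : EReal)) x
  have h2 := (add_le_add_right (add_le_add_left h1
    ((1 / (2 * ν) * ‖ν • (ζ - θ) - ν • ζ‖ ^ 2 : ℝ) : EReal))
    (localPrimal h ν ζ θ : EReal)).trans hgap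
  norm_cast at h2
  have h3 : ν • (ζ - θ) - ν • ζ = -(ν • θ) := by module
  have h4 : 1 / (2 * ν) * ‖ν • (ζ - θ) - ν • ζ‖ ^ 2 = ν / 2 * ‖θ‖ ^ 2 := by
    rw [h3, norm_neg, norm_smul, mul_pow, Real.norm_eq_abs, sq_abs]
    field_simp
  have h5 : inner ℝ (ν • (ζ - θ)) θ = ν * inner ℝ ζ θ - ν * ‖θ‖ ^ 2 := by
    rw [real_inner_smul_left, inner_sub_left, real_inner_self_eq_norm_sq]; ring
  rw [h4, localPrimal] at h2
  linarith

/-! ### Momentum scalars and the accelerated energy estimate. -/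

theorem tSeq_zero_succ (n : ℕ) : tSeq 0 (n + 1) = (1 + √(1 + 4 * tSeq 0 n ^ 2)) / 2 := by
  simp [tSeq]

theorem tSeq_zero_sq (n : ℕ) : tSeq 0 (n + 1) ^ 2 - tSeq 0 (n + 1) = tSeq 0 n ^ 2 := by
  have h := Real.sq_sqrt (show (0 : ℝ) ≤ 1 + 4 * tSeq 0 n ^ 2 by positivity)
  rw [tSeq_zero_succ]
  linear_combination h / 4

theorem tSeq_zero_bounds (n : ℕ) : ((n : ℝ) + 2) / 2 ≤ tSeq 0 n ∧ tSeq 0 n ≤ n + 1 := by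
  induction n with
  | zero => simp [tSeq]
  | succ n ih =>
    obtain ⟨h1, h2⟩ := ih
    have hn : (0 : ℝ) ≤ n := n.cast_nonneg
    rw [tSeq_zero_succ]
    push_cast
    have h3 : 2 * tSeq 0 n ≤ √(1 + 4 * tSeq 0 n ^ 2) := Real.le_sqrt_of_sq_le (by nlinarith)
    have h4 : √(1 + 4 * tSeq 0 n ^ 2) ≤ 1 + 2 * tSeq 0 n :=
      Real.sqrt_le_iff.2 ⟨by linarith, by nlinarith⟩
    constructor <;> linarith

theorem betaSeq_zero (n : ℕ) : betaSeq 0 n = (tSeq 0 n - 1) / tSeq 0 (n + 1) := by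
  simp [betaSeq]

/-- The energy estimate of the accelerated proximal gradient method with absolute errors `e`,
for a sequence `u` of iterates with optimality gaps `D` and extrapolated points `w`. -/
theorem accelerated_energy_le {H : Type*} [NormedAddCommGroup H] [InnerProductSpace ℝ H]
    {κ : ℝ} {u w : ℕ → H} {a : H} {D e : ℕ → ℝ}
    (hw : ∀ n, w (n + 1) = u (n + 1) + betaSeq 0 n • (u (n + 1) - u n))
    (hopt : ∀ n, D (n + 1) ≤ κ / 2 * (‖a - w n‖ ^ 2 - ‖a - u (n + 1)‖ ^ 2) + e n)
    (hdesc : ∀ n, D (n + 2) ≤ D (n + 1) +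
      κ / 2 * (‖u (n + 1) - w (n + 1)‖ ^ 2 - ‖u (n + 1) - u (n + 2)‖ ^ 2) + e (n + 1)) (n : ℕ) :
    tSeq 0 n ^ 2 * D (n + 1) + κ / 2 * ‖u n + tSeq 0 n • (u (n + 1) - u n) - a‖ ^ 2 ≤
      κ / 2 * ‖a - w 0‖ ^ 2 + ∑ k ∈ Finset.range (n + 1), tSeq 0 k ^ 2 * e k := by
  induction n with
  | zero =>
    have h1 := hopt 0
    simp only [tSeq, zero_add, Finset.range_one, Finset.sum_singleton, one_smul,
      add_sub_cancel] at h1 ⊢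
    rw [norm_sub_rev (u 1) a]
    linarith
  | succ n ih =>
    rw [Finset.sum_range_succ]
    have ht := tSeq_zero_sq n
    have hb := (tSeq_zero_bounds (n + 1)).1
    have hn : (0 : ℝ) ≤ n := n.cast_nonneg
    push_cast at hb
    set t := tSeq 0 (n + 1) with htdef
    have ht1 : 1 ≤ t := by linarith
    have ht0 : t ≠ 0 := by positivity
    -- Uses `t βₙ = tₙ - 1`.
    have hz : u n + tSeq 0 n • (u (n + 1) - u n) - a =
        t • (w (n + 1) - u (n + 1)) + (u (n + 1) - a) := by
      rw [hw, betaSeq_zero, ← htdef, add_sub_cancel_left, smul_smul, mul_div_cancel₀ _ ht0]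
      module
    have hz' : u (n + 1) + t • (u (n + 2) - u (n + 1)) - a =
        t • (u (n + 2) - u (n + 1)) + (u (n + 1) - a) := by module
    have hid : ∀ p q : H, ‖t • p + q‖ ^ 2 = t * (t - 1) * ‖p‖ ^ 2 + t * ‖p + q‖ ^ 2
        + (1 - t) * ‖q‖ ^ 2 := by
      intro p q
      rw [norm_add_sq_real, norm_add_sq_real, norm_smul, mul_pow, Real.norm_eq_abs, sq_abs,
        real_inner_smul_left]
      ring
    rw [hz, hid] at ih
    rw [show n + 1 + 1 = n + 2 from rfl, hz', hid]
    have e1 : w (n + 1) - u (n + 1) + (u (n + 1) - a) = w (n + 1) - a := by abel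
    have e2 : u (n + 2) - u (n + 1) + (u (n + 1) - a) = u (n + 2) - a := by abel
    rw [e1, ← ht] at ih
    rw [e2]
    -- Weights `t` and `t(t - 1) = tₙ²` add up to `t²` and match the identity `hid`.
    have h1 := mul_le_mul_of_nonneg_left (hopt (n + 1)) (by linarith : 0 ≤ t)
    have h2 := mul_le_mul_of_nonneg_left (hdesc n) (mul_nonneg (by linarith : 0 ≤ t)
      (by linarith : 0 ≤ t - 1))
    rw [norm_sub_rev a, norm_sub_rev a] at h1
    rw [norm_sub_rev (u (n + 1)), norm_sub_rev (u (n + 1))] at h2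
    simp only [show n + 1 + 1 = n + 2 from rfl] at h1 ih
    linarith

/-! ### DualFL as a dual proximal gradient method. -/

/-- One inexact proximal gradient step for the dual objective
`∑ⱼ Cⱼ(yⱼ) + (κ/(2N))‖∑ⱼ yⱼ‖²`. -/
theorem dual_step_le {Ω : Type*} [NormedAddCommGroup Ω] [InnerProductSpace ℝ Ω] {N : ℕ}
    (hN : 0 < N) {κ ε : ℝ} (hκ : 0 ≤ κ) {u w y : Fin N → Ω} {Cu Cy : Fin N → ℝ}
    (h : ∀ j, Cu j + κ * inner ℝ (w j - (1 / (N : ℝ)) • ∑ i, w i - u j) (y j - u j) - ε ≤ Cy j) :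
    ∑ j, Cu j + κ / (2 * N) * ‖∑ j, u j‖ ^ 2 ≤ ∑ j, Cy j + κ / (2 * N) * ‖∑ j, y j‖ ^ 2 +
      κ / 2 * (∑ j, ‖y j - w j‖ ^ 2 - ∑ j, ‖y j - u j‖ ^ 2) + N * ε := by
  have hN' : (0 : ℝ) < N := by exact_mod_cast hN
  have h1 := Finset.sum_le_sum fun j (_ : j ∈ Finset.univ) => h j
  have h2 : ∀ j, inner ℝ (w j - (1 / (N : ℝ)) • ∑ i, w i - u j) (y j - u j) =
      (‖y j - u j‖ ^ 2 + ‖u j - w j‖ ^ 2 - ‖y j - w j‖ ^ 2) * (1 / 2)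
        - 1 / (N : ℝ) * inner ℝ (∑ i, w i) (y j - u j) := by
    intro j
    have e1 : y j - w j = (y j - u j) + (u j - w j) := by abel
    have e2 : w j - (1 / (N : ℝ)) • ∑ i, w i - u j =
      -(u j - w j) - (1 / (N : ℝ)) • ∑ i, w i := by abel
    rw [e1, norm_add_sq_real, e2, inner_sub_left, inner_neg_left, real_inner_smul_left,
      real_inner_comm (u j - w j)]
    ring
  simp only [h2, Finset.sum_sub_distrib, Finset.sum_add_distrib, ← Finset.mul_sum,
    ← Finset.sum_mul, ← inner_sum, Finset.sum_const, Finset.card_univ, Fintype.card_fin,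
    nsmul_eq_mul] at h1
  -- Cauchy-Schwarz: the quadratic part has a `κ`-Lipschitz gradient, which is what allows the step
  -- `1/κ`.
  have h3 : ‖∑ j, u j - ∑ j, w j‖ ^ 2 ≤ N * ∑ j, ‖u j - w j‖ ^ 2 := by
    rw [← Finset.sum_sub_distrib]
    refine (pow_le_pow_left₀ (norm_nonneg _) (norm_sum_le _ _) 2).trans ?_
    simpa using sq_sum_le_card_mul_sum_sq (s := (Finset.univ : Finset (Fin N)))
      (f := fun j => ‖u j - w j‖)
  have h4 : ‖∑ j, u j - ∑ j, w j‖ ^ 2 - ‖∑ j, y j - ∑ j, w j‖ ^ 2 =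
      ‖∑ j, u j‖ ^ 2 - ‖∑ j, y j‖ ^ 2 + 2 * inner ℝ (∑ j, w j) (∑ j, y j - ∑ j, u j) := by
    rw [norm_sub_sq_real, norm_sub_sq_real, inner_sub_right, real_inner_comm (∑ j, w j),
      real_inner_comm (∑ j, w j)]
    ring
  have h5 : ‖∑ j, u j‖ ^ 2 - ‖∑ j, y j‖ ^ 2 + 2 * inner ℝ (∑ j, w j) (∑ j, y j - ∑ j, u j) ≤
      N * ∑ j, ‖u j - w j‖ ^ 2 := by
    nlinarith [sq_nonneg ‖∑ j, y j - ∑ j, w j‖]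
  have h6 := mul_le_mul_of_nonneg_left h5 (by positivity : 0 ≤ κ / (2 * N))
  have h7 : κ / (2 * N) * (N * ∑ j, ‖u j - w j‖ ^ 2) = κ / 2 * ∑ j, ‖u j - w j‖ ^ 2 := by
    field_simp
  have h8 : κ / (2 * N) * (‖∑ j, u j‖ ^ 2 - ‖∑ j, y j‖ ^ 2 +
      2 * inner ℝ (∑ j, w j) (∑ j, y j - ∑ j, u j)) =
      κ / (2 * N) * ‖∑ j, u j‖ ^ 2 - κ / (2 * N) * ‖∑ j, y j‖ ^ 2 +
      κ * (1 / N * inner ℝ (∑ j, w j) (∑ j, y j - ∑ j, u j)) := by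
    field_simp
  rw [h7, h8] at h6
  linarith

/-- The dual iterates `uⱼ⁽ⁿ⁾ = ζⱼ⁽ⁿ⁻¹⁾ - θⱼ⁽ⁿ⁾`. -/
noncomputable def dualIterate {Ω : Type*} [NormedAddCommGroup Ω] [InnerProductSpace ℝ Ω] {N : ℕ}
    (φ ζ : ℕ → Fin N → Ω) (n : ℕ) (j : Fin N) : Ω :=
  previous ζ n j - φ n j

/-- The extrapolated dual iterates. -/
noncomputable def extrapolated {Ω : Type*} [NormedAddCommGroup Ω] [InnerProductSpace ℝ Ω] {N : ℕ}
    (φ ζ : ℕ → Fin N → Ω) : ℕ → Fin N → Ω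
  | 0 => 0
  | n + 1 => fun j => dualIterate φ ζ (n + 1) j +
      betaSeq 0 n • (dualIterate φ ζ (n + 1) j - dualIterate φ ζ n j)

section Run

variable {Ω : Type*} [NormedAddCommGroup Ω] [InnerProductSpace ℝ Ω] {N : ℕ}
  {θ : ℕ → Ω} {φ ζ : ℕ → Fin N → Ω}

theorem IsRun.sum_local (hN : 0 < N) (h : IsRun 0 θ φ ζ) (n : ℕ) :
    ∑ j, φ n j = (N : ℝ) • θ n := by
  have hN' : (N : ℝ) ≠ 0 := by exact_mod_cast hN.ne'
  cases n with
  | zero => simp [h.server_zero, h.local_zero]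
  | succ n => rw [h.server_succ, smul_smul, mul_one_div_cancel hN', one_smul]

theorem IsRun.sum_control (hN : 0 < N) (h : IsRun 0 θ φ ζ) (n : ℕ) :
    ∑ j, previous ζ n j = 0 ∧ ∑ j, ζ n j = 0 := by
  induction n with
  | zero => simp [previous, h.control_zero]
  | succ n ih =>
    refine ⟨ih.2, ?_⟩
    simp only [h.control_succ, Finset.sum_sub_distrib, Finset.sum_add_distrib,
      ← Finset.smul_sum, ih.1, ih.2, h.sum_local hN, Finset.sum_const, Finset.card_univ,
      Fintype.card_fin, Nat.cast_smul_eq_nsmul]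
    simp

theorem IsRun.sum_dualIterate (hN : 0 < N) (h : IsRun 0 θ φ ζ) (n : ℕ) :
    ∑ j, dualIterate φ ζ n j = -((N : ℝ) • θ n) := by
  simp [dualIterate, (h.sum_control hN n).1, h.sum_local hN]

/-- The control variates sum to zero, so `θ⁽ⁿ⁾` is minus the mean of the `u_j⁽ⁿ⁾` and adding it
centers them. Centering is the gradient step for the quadratic part. -/
theorem IsRun.control_eq (hN : 0 < N) (h : IsRun 0 θ φ ζ) (n : ℕ) (j : Fin N) :
    ζ n j = extrapolated φ ζ n j - (1 / (N : ℝ)) • ∑ i, extrapolated φ ζ n i := by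
  have hN' : (N : ℝ) ≠ 0 := by exact_mod_cast hN.ne'
  cases n with
  | zero => simp [extrapolated, h.control_zero]
  | succ n =>
    simp only [extrapolated, Finset.sum_add_distrib, ← Finset.smul_sum, Finset.sum_sub_distrib,
      h.sum_dualIterate hN, h.control_succ]
    simp only [dualIterate, previous]
    match_scalars <;> field_simp <;> ring

end Run

/-! ### Convergence for fixed `α`. -/

/-- Dual optimality: the dual gap controls the distance of the primal points. -/
theorem dual_gap_ge {Ω : Type*} [NormedAddCommGroup Ω] [InnerProductSpace ℝ Ω] {N : ℕ}
    (hN : 0 < N) {κ : ℝ} {u a : Fin N → Ω} {x y : Ω} {C Ca : Fin N → ℝ}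
    (hu : ∑ j, u j = -((N : ℝ) • x)) (ha : ∑ j, a j = -((N : ℝ) • y))
    (h : ∀ j, Ca j + κ * inner ℝ (u j - a j) y ≤ C j) :
    κ * N / 2 * ‖x - y‖ ^ 2 ≤ ∑ j, C j + κ / (2 * N) * ‖∑ j, u j‖ ^ 2 -
      (∑ j, Ca j + κ / (2 * N) * ‖∑ j, a j‖ ^ 2) := by
  have hN' : (0 : ℝ) < N := by exact_mod_cast hN
  have h1 := Finset.sum_le_sum fun j (_ : j ∈ Finset.univ) => h j
  rw [Finset.sum_add_distrib, ← Finset.mul_sum, ← sum_inner, Finset.sum_sub_distrib, hu, ha,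
    inner_sub_left, inner_neg_left, inner_neg_left, real_inner_smul_left, real_inner_smul_left,
    real_inner_self_eq_norm_sq] at h1
  have h2 : ∀ z : Ω, κ / (2 * N) * ‖-((N : ℝ) • z)‖ ^ 2 = κ * N / 2 * ‖z‖ ^ 2 := by
    intro z
    rw [norm_neg, norm_smul, mul_pow, Real.norm_eq_abs, sq_abs]
    field_simp
  rw [hu, ha, h2, h2, norm_sub_sq_real]
  linarith

/-- The weighted errors of the local solvers are summable. -/
theorem exists_bound_sum_errors {κ γ : ℝ} (hκ : 0 < κ) (hγ : 0 < γ) {N : ℕ} (hN : 0 < N) :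
    ∃ B : ℝ, ∀ n : ℕ, ∑ k ∈ Finset.range n,
      tSeq 0 k ^ 2 * (N * (1 / ((N : ℝ) * κ * ((k : ℝ) + 1) ^ (4 + γ)))) ≤ B := by
  have hN' : (0 : ℝ) < N := by exact_mod_cast hN
  have hs : Summable fun k : ℕ => κ⁻¹ * (1 / ((k : ℝ) + 1) ^ 2) := by
    refine Summable.mul_left _ ?_
    have := (summable_nat_add_iff 1).2 (Real.summable_one_div_nat_pow.2 one_lt_two)
    simpa using this
  refine ⟨∑' k : ℕ, κ⁻¹ * (1 / ((k : ℝ) + 1) ^ 2), fun n => ?_⟩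
  refine (Finset.sum_le_sum fun k _ => ?_).trans
    (hs.sum_le_tsum (Finset.range n) fun k _ => by positivity)
  have hk : (0 : ℝ) ≤ k := k.cast_nonneg
  obtain ⟨h1, h2⟩ := tSeq_zero_bounds k
  -- Against `t_k² ≤ (k + 1)²`, the exponent 4 already leaves the summable `(k + 1)⁻²`.
  have h3 : ((k : ℝ) + 1) ^ 4 ≤ ((k : ℝ) + 1) ^ (4 + γ) := by
    rw [← Real.rpow_natCast]
    exact Real.rpow_le_rpow_of_exponent_le (by linarith) (by push_cast; linarith)
  have h4 : tSeq 0 k ^ 2 ≤ ((k : ℝ) + 1) ^ 2 := pow_le_pow_left₀ (by linarith) h2 2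
  have h5 : (N : ℝ) * (1 / ((N : ℝ) * κ * ((k : ℝ) + 1) ^ (4 + γ))) =
      κ⁻¹ * (1 / ((k : ℝ) + 1) ^ (4 + γ)) := by
    field_simp
  have h6 : 1 / ((k : ℝ) + 1) ^ (4 + γ) ≤ 1 / ((k : ℝ) + 1) ^ 4 :=
    one_div_le_one_div_of_le (by positivity) h3
  rw [h5]
  calc tSeq 0 k ^ 2 * (κ⁻¹ * (1 / ((k : ℝ) + 1) ^ (4 + γ)))
      ≤ ((k : ℝ) + 1) ^ 2 * (κ⁻¹ * (1 / ((k : ℝ) + 1) ^ 4)) := by gcongr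
    _ = κ⁻¹ * (1 / ((k : ℝ) + 1) ^ 2) := by field_simp

/-- The server parameters of DualFL converge to the point whose (scaled) subgradients are
balanced, which is the minimizer of the regularized cost. -/
theorem IsRun.tendsto_server {Ω : Type*} [NormedAddCommGroup Ω] [InnerProductSpace ℝ Ω] {N : ℕ}
    (hN : 0 < N) {f : Fin N → Ω → ℝ} {α γ : ℝ} (hα : 0 < α) (hγ : 0 < γ)
    {θ : ℕ → Ω} {φ ζ : ℕ → Fin N → Ω} (hrun : IsRun 0 θ φ ζ)
    (hacc : IsAccurate (regularize f α) α γ φ ζ) {y : Ω} {a : Fin N → Ω}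
    (ha : ∑ j, a j = -((N : ℝ) • y))
    (hsub : ∀ j x, f j y + inner ℝ (α • a j) (x - y) ≤ f j x) :
    Tendsto θ atTop (𝓝 y) := by
  have hN' : (0 : ℝ) < N := by exact_mod_cast hN
  set u := dualIterate φ ζ with hu
  set w := extrapolated φ ζ with hw
  set ε : ℕ → ℝ := fun n => 1 / ((N : ℝ) * α * ((n : ℝ) + 1) ^ (4 + γ)) with hε
  -- The computed point is an `ε`-subgradient of `f_j*` at `α u_j`, so the error enters the step
  -- additively, without square-root terms.
  have hgap : ∀ n j x, inner ℝ (α • u (n + 1) j) x - f j x ≤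
      inner ℝ (α • u (n + 1) j) (φ (n + 1) j) - f j (φ (n + 1) j) + ε n := by
    intro n j x
    have := approx_subgradient_of_gap_le hα.ne' (hacc n j) x
    simp only [regularize, add_sub_cancel_right] at this
    exact this
  -- The real supremum is a true conjugate value for indices `n + 1`, where `hgap` bounds it; index
  -- 0 is never used.
  let C : ℕ → Fin N → ℝ := fun n j => ⨆ x, (inner ℝ (α • u n j) x - f j x)
  have hC : ∀ n j x, inner ℝ (α • u (n + 1) j) x - f j x ≤ C (n + 1) j := fun n j x =>
    le_ciSup (f := fun x => inner ℝ (α • u (n + 1) j) x - f j x)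
      ⟨_, by rintro _ ⟨z, rfl⟩; exact hgap n j z⟩ x
  have hC' : ∀ n j, C (n + 1) j ≤
      inner ℝ (α • u (n + 1) j) (φ (n + 1) j) - f j (φ (n + 1) j) + ε n := fun n j =>
    ciSup_le (hgap n j)
  let Ca : Fin N → ℝ := fun j => inner ℝ (α • a j) y - f j y
  have hCa : ∀ j x, inner ℝ (α • a j) x - f j x ≤ Ca j := by
    intro j x
    have := hsub j x
    rw [inner_sub_right] at this
    simp only [Ca]
    linarith
  have hφ : ∀ n j, φ (n + 1) j = w n j - (1 / (N : ℝ)) • ∑ i, w n i - u (n + 1) j := by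
    intro n j
    rw [← hrun.control_eq hN n j, hu]
    simp [dualIterate, previous]
  have hstep : ∀ n (v : Fin N → Ω) (Cv : Fin N → ℝ),
      (∀ j x, inner ℝ (α • v j) x - f j x ≤ Cv j) →
      ∑ j, C (n + 1) j + α / (2 * N) * ‖∑ j, u (n + 1) j‖ ^ 2 ≤
        ∑ j, Cv j + α / (2 * N) * ‖∑ j, v j‖ ^ 2 +
        α / 2 * (∑ j, ‖v j - w n j‖ ^ 2 - ∑ j, ‖v j - u (n + 1) j‖ ^ 2) + N * ε n := by
    intro n v Cv hv
    refine dual_step_le hN hα.le fun j => ?_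
    rw [← hφ n j]
    have h1 := hv j (φ (n + 1) j)
    have h2 := hC' n j
    rw [real_inner_smul_left] at h1 h2
    rw [inner_sub_right, real_inner_comm, real_inner_comm (u (n + 1) j)]
    linarith
  let Da : ℝ := ∑ j, Ca j + α / (2 * N) * ‖∑ j, a j‖ ^ 2
  let D : ℕ → ℝ := fun n => ∑ j, C n j + α / (2 * N) * ‖∑ j, u n j‖ ^ 2 - Da
  have hD : ∀ n, α * N / 2 * ‖θ (n + 1) - y‖ ^ 2 ≤ D (n + 1) := by
    intro n
    refine dual_gap_ge hN (hrun.sum_dualIterate hN (n + 1)) ha fun j => ?_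
    have := hC n j y
    simp only [Ca]
    rw [real_inner_smul_left] at this ⊢
    rw [inner_sub_left]
    linarith
  -- The energy estimate needs the Euclidean product norm, not the default sup norm.
  have hnorm : ∀ p q : Fin N → Ω,
      ‖WithLp.toLp 2 p - WithLp.toLp 2 q‖ ^ 2 = ∑ j, ‖p j - q j‖ ^ 2 := by
    intro p q
    rw [PiLp.norm_sq_eq_of_L2]
    rfl
  have henergy := accelerated_energy_le (κ := α) (u := fun n => WithLp.toLp 2 (u n))
    (w := fun n => WithLp.toLp 2 (w n)) (a := WithLp.toLp 2 a) (D := D) (e := fun n => N * ε n)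
    (fun n => rfl)
    (fun n => by
      rw [hnorm, hnorm]
      have := hstep n a Ca hCa
      simp only [D, Da]
      linarith)
    (fun n => by
      rw [hnorm, hnorm]
      have := hstep (n + 1) (u (n + 1)) (C (n + 1)) (hC n)
      simp only [D]
      linarith)
  obtain ⟨B, hB⟩ := exists_bound_sum_errors hα hγ hN
  set M : ℝ := α / 2 * ‖WithLp.toLp 2 a - WithLp.toLp 2 (w 0)‖ ^ 2 + B with hM
  have hbound : ∀ n : ℕ, ‖θ (n + 1) - y‖ ^ 2 ≤ (8 * M / (α * N)) * (1 / ((n : ℝ) + 1)) := by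
    intro n
    have h1 := henergy n
    have h2 := hB (n + 1)
    have h3 : tSeq 0 n ^ 2 * D (n + 1) ≤ M := by
      have : 0 ≤ α / 2 * ‖WithLp.toLp 2 (u n) + tSeq 0 n •
        (WithLp.toLp 2 (u (n + 1)) - WithLp.toLp 2 (u n)) - WithLp.toLp 2 a‖ ^ 2 := by positivity
      simp only [hε] at h1
      linarith
    have h4 := (tSeq_zero_bounds n).1
    have hn : (0 : ℝ) ≤ n := n.cast_nonneg
    have h5 : ((n : ℝ) + 1) / 4 ≤ tSeq 0 n ^ 2 := by nlinarith
    have h6 : ((n : ℝ) + 1) / 4 * (α * N / 2 * ‖θ (n + 1) - y‖ ^ 2) ≤ M :=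
      (mul_le_mul h5 (hD n) (by positivity) (by positivity)).trans h3
    rw [mul_one_div, div_div, le_div_iff₀ (by positivity)]
    linarith
  rw [← tendsto_add_atTop_iff_nat 1, tendsto_iff_norm_sub_tendsto_zero]
  have h1 : Tendsto (fun n : ℕ => ‖θ (n + 1) - y‖ ^ 2) atTop (𝓝 0) := by
    refine squeeze_zero (fun n => by positivity) hbound ?_
    simpa using tendsto_one_div_add_atTop_nhds_zero_nat.const_mul (8 * M / (α * N))
  simpa using h1.sqrt

/-! ### Regularized minimizers and the limit `α → 0⁺`. -/

theorem exists_isMin_regularized {Ω : Type*} [NormedAddCommGroup Ω] [InnerProductSpace ℝ Ω]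
    [FiniteDimensional ℝ Ω] {N : ℕ} {f : Fin N → Ω → ℝ} (hcont : ∀ j, Continuous (f j))
    (hcoer : Tendsto (cost f) (Bornology.cobounded Ω) atTop) {α : ℝ} (hα : 0 < α) :
    ∃ y, ∀ x, cost f y + α / 2 * ‖y‖ ^ 2 ≤ cost f x + α / 2 * ‖x‖ ^ 2 := by
  have : ProperSpace Ω := FiniteDimensional.proper ℝ Ω
  have hc : Continuous fun x => cost f x + α / 2 * ‖x‖ ^ 2 := by
    unfold cost
    fun_prop
  refine hc.exists_forall_le ?_
  rw [← Metric.cobounded_eq_cocompact]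
  exact tendsto_atTop_mono (fun x => le_add_of_nonneg_right (by positivity)) hcoer

end DualFL

theorem theorem4p1 {Ω : Type*} [NormedAddCommGroup Ω] [InnerProductSpace ℝ Ω]
    [FiniteDimensional ℝ Ω] {N : ℕ} (hN : 0 < N) (f : Fin N → Ω → ℝ)
    (hcont : ∀ j, Continuous (f j)) (hconv : ∀ j, ConvexOn ℝ Set.univ (f j))
    (hcoer : Tendsto (DualFL.cost f) (Bornology.cobounded Ω) atTop)
    (θstar : Ω) (hmin : ∀ θ, DualFL.cost f θstar ≤ DualFL.cost f θ) :
    ∃ l : ℝ → ℝ, Tendsto l (𝓝[>] 0) (𝓝 0) ∧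
      ∀ α : ℝ, 0 < α → ∀ γ : ℝ, 0 < γ →
        ∀ (θ : ℕ → Ω) (φ ζ : ℕ → Fin N → Ω),
          DualFL.IsRun 0 θ φ ζ →
          DualFL.IsAccurate (DualFL.regularize f α) α γ φ ζ →
          Tendsto (fun n => DualFL.cost f (θ n) - DualFL.cost f θstar) atTop (𝓝 (l α)) := by
  have hN' : (0 : ℝ) < N := by exact_mod_cast hN
  -- Fixing `y α` before any run makes the limit independent of the run and of `γ`.
  have hex : ∀ α : ℝ, ∃ y, 0 < α → ∀ x, DualFL.cost f y + α / 2 * ‖y‖ ^ 2 ≤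
      DualFL.cost f x + α / 2 * ‖x‖ ^ 2 := by
    intro α
    by_cases hα : 0 < α
    · obtain ⟨y, hy⟩ := DualFL.exists_isMin_regularized hcont hcoer hα
      exact ⟨y, fun _ => hy⟩
    · exact ⟨0, fun h => absurd h hα⟩
  choose y hy using hex
  refine ⟨fun α => DualFL.cost f (y α) - DualFL.cost f θstar, ?_, ?_⟩
  · have h1 : Tendsto (fun α : ℝ => α / 2 * ‖θstar‖ ^ 2) (𝓝[>] 0) (𝓝 0) := by
      have : Tendsto (fun α : ℝ => α / 2 * ‖θstar‖ ^ 2) (𝓝 0) (𝓝 (0 / 2 * ‖θstar‖ ^ 2)) :=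
        (by fun_prop : Continuous fun α : ℝ => α / 2 * ‖θstar‖ ^ 2).tendsto 0
      simpa using this.mono_left nhdsWithin_le_nhds
    refine tendsto_of_tendsto_of_tendsto_of_le_of_le' tendsto_const_nhds h1 ?_ ?_
    · exact Eventually.of_forall fun α => sub_nonneg.2 (hmin _)
    · filter_upwards [self_mem_nhdsWithin] with α hα
      have h2 := hy α hα θstar
      have h3 : 0 ≤ α / 2 * ‖y α‖ ^ 2 := by
        have : (0 : ℝ) < α := hα
        positivity
      linarith
  · intro α hα γ hγ θ φ ζ hrun hacc
    have hsum : ConvexOn ℝ Set.univ fun x => ∑ j, f j x := by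
      refine ⟨convex_univ, fun x _ z _ a b ha hb hab => ?_⟩
      simp only [Finset.smul_sum, ← Finset.sum_add_distrib]
      exact Finset.sum_le_sum fun j _ => (hconv j).2 trivial trivial ha hb hab
    have hmin' : ∀ x, ∑ j, f j (y α) + N * α / 2 * ‖y α‖ ^ 2 ≤
        ∑ j, f j x + N * α / 2 * ‖x‖ ^ 2 := by
      intro x
      have h1 := mul_le_mul_of_nonneg_left (hy α hα x) hN'.le
      simp only [DualFL.cost, mul_add, ← mul_assoc, mul_one_div_cancel hN'.ne', one_mul] at h1
      linarith
    obtain ⟨p, hp, hsub⟩ := DualFL.exists_subgradients_of_sum f hcont hconv (y α) _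
      (DualFL.subgradient_of_isMin_add_sq hsum hmin')
    have hy' : Tendsto θ atTop (𝓝 (y α)) := by
      -- Dividing by `α` turns the sum `-Nα y` of the subgradients into `-N y`.
      refine hrun.tendsto_server hN hα hγ hacc (a := fun j => α⁻¹ • p j) ?_ fun j x => ?_
      · rw [← Finset.smul_sum, hp, smul_smul, ← neg_smul]
        congr 1
        field_simp
      · rw [smul_inv_smul₀ hα.ne']
        exact hsub j x
    have hc : Continuous (DualFL.cost f) := by
      unfold DualFL.cost
      fun_prop
    exact ((hc.tendsto _).comp hy').sub_const _
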